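/- Fix $d\in\mathbb{N}$ and $\hat\lambda>0$. Time–space points are $(t,x)\in[0,\infty)\times\mathbb{R}$, and functions take values in $\mathbb{R}^d$ and are defined at every point. Definitions. A space-like curve is a curve $\{t=\gamma(x):x\in(a,b)\}\subset[0,\infty)\times\mathbb{R}$, $(a,b)$ bounded, with $|\gamma(x_2)-\gamma(x_1)|<(x_2-x_1)/\hat\lambda$ for $a<x_1<x_2<b$; it extends by continuity to $[a,b]$, with the same strict inequality. $\mathrm{Tot.Var.}\{u;\gamma\}$ is the supremum of $\sum_i|u(\gamma(x_i),x_i)-u(\gamma(x_{i-1}),x_{i-1})|$ over all $x_0<\dots<x_m$ in $(a,b)$. The curve $\gamma$ on $(a,b)$ dominates the curve $\gamma'$ on $(a',b')$ if $a\le a'<b'\le b$ and $\gamma(x)\le\gamma'(x)\le\min\{\gamma(a)+\frac{x-a}{\hat\lambda},\ \gamma(b)+\frac{b-x}{\hat\lambda}\}$ for all $x\in(a',b')$. A function $u$ verifies Condition H with constant $C$ if $\mathrm{Tot.Var.}\{u;\gamma'\}\le C\,\mathrm{Tot.Var.}\{u;\gamma\}$ whenever $\gamma,\gamma'$ are space-like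 curves and $\gamma$ dominates $\gamma'$. A function $u$ on $[0,\infty)\times\mathbb{R}$ is piecewise constant if it is locally constant off a closed set which meets every bounded segment of every line $t=\mathrm{const}\ge0$ in finitely many points. We put $\|f\|_{BV(\mathbb{R})}=\|f\|_{L^\infty(\mathbb{R})}+\mathrm{Tot.Var.}(f)$, where $\mathrm{Tot.Var.}(f)$ is the supremum of $\sum_i|f(x_i)-f(x_{i-1})|$ over all $x_0<\dots<x_m$ in $\mathbb{R}$. A function $u\in L^\infty(\mathbb{R}^+\times\mathbb{R})$ verifies the Bounded Variation Condition if it has a representative (necessarily unique), again denoted $u$, such that $u(t,\cdot)$ is right-continuous for every $t\ge0$ and $t\mapsto u(t,\cdot)$ is continuous from $[0,\infty)$ to $L^1_{loc}(\mathbb{R})$, and there is $\delta>0$ such that for every space-like curve $\{t=\gamma(x):x\in[a',b']\}\subset[0,\infty)\times\mathbb{R}$ with $|\gamma(x_1)-\gamma(x_2)|\le\delta|x_1-x_2|$ for all $x_1,x_2\in[a',b']$, the function $x\mapsto u(\gamma(x),x)$ has bounded variation on $[a',b']$. Lemma. Let $(\psi_n)_{n\in\mathbb{N}}$ be piecewise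 constant functions that are uniformly bounded in $L^\infty(\mathbb{R}^+;BV(\mathbb{R}))$: there is $M$ with $\|\psi_n(t,\cdot)\|_{BV(\mathbb{R})}\le M$ for all $n$ and almost every $t\ge0$. Assume that there is $C>0$ such that, for every $n$, $\psi_n$ verifies Condition H with constant $C$ and $$\|\psi_n(t,\cdot)-\psi_n(s,\cdot)\|_{L^1(\mathbb{R})}\le C|t-s|\qquad\text{for all }0<s<t.$$ Then there exist $\psi\in L^\infty(\mathbb{R}^+\times\mathbb{R})$ verifying the Bounded Variation Condition and one subsequence of $(\psi_n)$ which converges to $\psi$ in $C^0([0,T];L^2(-R,R))$ for every $T>0$ and $R>0$, and almost everywhere in $\mathbb{R}^+\times\mathbb{R}$. (Here $\psi$ is taken to be the representative above, and the $\psi_n$ and $\psi$ do belong to $C^0([0,T];L^2(-R,R))$.) -/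

import Mathlib

open MeasureTheory Filter Topology Set
open scoped ENNReal

namespace SpaceLike

/-- State space `ℝ^d` with the Euclidean norm. -/
abbrev State (d : ℕ) : Type := EuclideanSpace ℝ (Fin d)

/-- Lebesgue measure on the space-time half plane `[0,∞) × ℝ` of points `(t, x)`. -/
noncomputable def halfPlane : Measure (ℝ × ℝ) :=
  (volume : Measure (ℝ × ℝ)).restrict (Ici (0 : ℝ) ×ˢ (univ : Set ℝ))

/-- Lebesgue measure on the interval `(-R, R)`. -/
noncomputable def interval (R : ℝ) : Measure ℝ :=
  (volume : Measure ℝ).restrict (Ioo (-R) R)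

/-- A space-like curve `{t = γ x}` over `(a, b)` with slope constant `lam`, contained in
`[0,∞) × ℝ`. Being Lipschitz, a space-like curve over `(a, b)` extends uniquely to `[a, b]`, and
the extension satisfies the same strict inequality; we always use that extension, so
`γ a` and `γ b` are the end-point values of the curve. -/
def IsSpaceLike (lam : ℝ) (γ : ℝ → ℝ) (a b : ℝ) : Prop :=
  (∀ x ∈ Icc a b, 0 ≤ γ x) ∧
    ∀ x₁ ∈ Icc a b, ∀ x₂ ∈ Icc a b, x₁ < x₂ → |γ x₂ - γ x₁| < (x₂ - x₁) / lam

/-- The curve `γ` over `(a, b)` dominates the curve `γ'` over `(a', b')`. -/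
def Dominates (lam : ℝ) (γ : ℝ → ℝ) (a b : ℝ) (γ' : ℝ → ℝ) (a' b' : ℝ) : Prop :=
  a ≤ a' ∧ a' < b' ∧ b' ≤ b ∧
    ∀ x ∈ Ioo a' b', γ x ≤ γ' x ∧ γ' x ≤ min (γ a + (x - a) / lam) (γ b + (b - x) / lam)

/-- The total variation of `u` along the curve `{t = γ x}`, `x ∈ (a, b)`: the supremum of the sums
`∑ |u (γ xᵢ, xᵢ) - u (γ xᵢ₋₁, xᵢ₋₁)|` over all `x₀ < ⋯ < x_m` in `(a, b)`. -/
noncomputable def totVar {d : ℕ} (u : ℝ → ℝ → State d) (γ : ℝ → ℝ) (a b : ℝ) : ℝ≥0∞ :=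
  eVariationOn (fun x => u (γ x) x) (Ioo a b)

/-- Piecewise constant functions `u (t, x)` on `[0,∞) × ℝ`: `u` is locally constant off a closed
set of fronts which meets every bounded part of every line `t = const` in finitely many points.
The values on the fronts are not restricted. -/
def IsPiecewiseConstant {d : ℕ} (u : ℝ → ℝ → State d) : Prop :=
  ∃ Γ : Set (ℝ × ℝ), IsClosed Γ ∧
    (∀ t : ℝ, 0 ≤ t → ∀ R : ℝ, {x : ℝ | x ∈ Icc (-R) R ∧ (t, x) ∈ Γ}.Finite) ∧
    ∀ p : ℝ × ℝ, 0 ≤ p.1 → p ∉ Γ →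
      ∀ᶠ q in 𝓝[Ici (0 : ℝ) ×ˢ (univ : Set ℝ)] p, u q.1 q.2 = u p.1 p.2

/-- The `BV(ℝ)` norm: `L^∞` norm plus total variation (over all partitions). -/
noncomputable def bvNorm {d : ℕ} (f : ℝ → State d) : ℝ≥0∞ :=
  eLpNorm f ∞ volume + eVariationOn f univ

/-- The norm of `u` in `L^∞(ℝ⁺; BV(ℝ))` is at most `M`. -/
def LInftyBVBound {d : ℕ} (M : ℝ) (u : ℝ → ℝ → State d) : Prop :=
  ∀ᵐ t ∂((volume : Measure ℝ).restrict (Ici 0)), bvNorm (u t) ≤ ENNReal.ofReal M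

/-- The domination condition with constant `C`: if `γ` dominates `γ'`, then the total variation of
`u` along `γ'` is at most `C` times the one along `γ`. -/
def ConditionH {d : ℕ} (lam C : ℝ) (u : ℝ → ℝ → State d) : Prop :=
  ∀ (γ : ℝ → ℝ) (a b : ℝ) (γ' : ℝ → ℝ) (a' b' : ℝ),
    IsSpaceLike lam γ a b → IsSpaceLike lam γ' a' b' → Dominates lam γ a b γ' a' b' →
      totVar u γ' a' b' ≤ ENNReal.ofReal C * totVar u γ a b

/-- `‖u(t,·) - u(s,·)‖_{L¹(ℝ)} ≤ C |t - s|` for all `0 < s < t`. -/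
def LipschitzInTime {d : ℕ} (C : ℝ) (u : ℝ → ℝ → State d) : Prop :=
  ∀ s t : ℝ, 0 < s → s < t →
    eLpNorm (fun x => u t x - u s x) 1 volume ≤ ENNReal.ofReal (C * |t - s|)

/-- The Bounded Variation Condition. The first two fields say that `u` is the precise
representative of its almost everywhere class (right-continuous in `x` for every `t`, and with
`t ↦ u (t, ·)` continuous into `L¹_loc`); such a representative is unique, so that the traces
`x ↦ u (γ x, x)` in the third field are well defined by the class. -/
structure BoundedVariationCondition {d : ℕ} (lam : ℝ) (u : ℝ → ℝ → State d) : Prop where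
  right_continuous : ∀ t : ℝ, 0 ≤ t → ∀ x : ℝ, ContinuousWithinAt (u t) (Ici x) x
  time_continuous : ∀ t : ℝ, 0 ≤ t → ∀ R : ℝ,
    Tendsto (fun s => eLpNorm (fun x => u s x - u t x) 1 (interval R)) (𝓝[Ici 0] t) (𝓝 0)
  trace_bv : ∃ δ : ℝ, 0 < δ ∧ ∀ (γ : ℝ → ℝ) (a' b' : ℝ), IsSpaceLike lam γ a' b' →
    (∀ x₁ ∈ Icc a' b', ∀ x₂ ∈ Icc a' b', |γ x₁ - γ x₂| ≤ δ * |x₁ - x₂|) →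
      BoundedVariationOn (fun x => u (γ x) x) (Icc a' b')

/-- `u ∈ C⁰([0,T]; L²(-R,R))`. -/
def MemC0L2 {d : ℕ} (T R : ℝ) (u : ℝ → ℝ → State d) : Prop :=
  (∀ t ∈ Icc 0 T, MemLp (u t) 2 (interval R)) ∧
    ∀ t ∈ Icc 0 T,
      Tendsto (fun s => eLpNorm (fun x => u s x - u t x) 2 (interval R)) (𝓝[Icc 0 T] t) (𝓝 0)

/-- `un n → u` in `C⁰([0,T]; L²(-R,R))`. -/
def TendstoC0L2 {d : ℕ} (T R : ℝ) (un : ℕ → ℝ → ℝ → State d) (u : ℝ → ℝ → State d) : Prop :=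
  (∀ n, MemC0L2 T R (un n)) ∧ MemC0L2 T R u ∧
    Tendsto (fun n => ⨆ t ∈ Icc 0 T, eLpNorm (fun x => un n t x - u t x) 2 (interval R))
      atTop (𝓝 0)

end SpaceLike

/-! Compactness is Helly's theorem in space combined with equicontinuity in time. A diagonal
extraction at rational times gives almost everywhere convergence there, hence convergence in `L¹` on
bounded intervals; the common Lipschitz constant in time makes this uniform for bounded times
(`exists_subseq_uniform_cauchy`). Interpolation with the uniform sup bound turns `L¹` into `L²`.
Each slice of the limit is a function of bounded variation, so it may be replaced by its right
limits (`exists_subseq_limit`).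

For the traces, Condition H is applied to a wide horizontal segment at a time where the `BV` bound
holds: any space-like curve above it has variation at most `C * M` (`ConditionH.totVar_le`). This
bound must pass to the limit, although the slices converge only almost everywhere and a given curve
may run through exceptional points. Hence the curve is translated. An upward shift by `2⁻¹ ^ n`
places it strictly above a good horizontal line, even where it touches `t = 0`, and costs a summable
`L¹` error, so almost everywhere convergence survives (`ae_tendsto_time_shift`). A generic shift `s`
in space then makes all points of a partition good, and `s → 0⁺` is harmless by right-continuity
(`sum_edist_le_of_translates`).

Since values on fronts are arbitrary and the `BV` bound holds only for almost every time, the slice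
at `t = 0` is first corrected on a null set (`exists_extension`). -/

namespace SpaceLike

/-! ### Helly's selection principle. -/

section Helly

variable {E : Type*} [NormedAddCommGroup E]

/-- The increments of a function are controlled by the increments of its variation function. -/
theorem dist_le_variation_sub {f : ℝ → E} (hf : eVariationOn f univ ≠ ∞) {x y : ℝ} (hxy : x ≤ y) :
    dist (f x) (f y) ≤ (eVariationOn f (Iic y)).toReal - (eVariationOn f (Iic x)).toReal := by
  have hfin : ∀ s, eVariationOn f s ≠ ∞ := fun s =>
    ne_top_of_le_ne_top hf (eVariationOn.mono f (subset_univ s))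
  have h1 : eVariationOn f (Iic x) + eVariationOn f (Icc x y) ≤ eVariationOn f (Iic y) :=
    (eVariationOn.add_le_union f fun a ha b hb => le_trans ha hb.1).trans
      (eVariationOn.mono f (union_subset (Iic_subset_Iic.2 hxy) fun a ha => ha.2))
  have h2 : edist (f x) (f y) ≤ eVariationOn f (Icc x y) :=
    eVariationOn.edist_le f (left_mem_Icc.2 hxy) (right_mem_Icc.2 hxy)
  have h3 := (add_le_add_right h2 (eVariationOn f (Iic x))).trans h1
  rw [edist_dist, ← ENNReal.ofReal_toReal (hfin (Iic x)), ← ENNReal.ofReal_toReal (hfin (Iic y)),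
    ← ENNReal.ofReal_add ENNReal.toReal_nonneg dist_nonneg,
    ENNReal.ofReal_le_ofReal_iff ENNReal.toReal_nonneg] at h3
  linarith

/-- A pointwise limit inherits a uniform bound on the variation. -/
theorem eVariationOn_le_of_tendsto {ι : Type*} {l : Filter ι} [l.NeBot] {F : ι → ℝ → E} {f : ℝ → E}
    {s : Set ℝ} {V : ℝ≥0∞} (hF : ∀ x ∈ s, Tendsto (fun i => F i x) l (𝓝 (f x)))
    (hV : ∀ᶠ i in l, eVariationOn (F i) s ≤ V) : eVariationOn f s ≤ V := by
  by_contra! h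
  obtain ⟨i, hi, hi'⟩ := ((eVariationOn.lowerSemicontinuous_aux hF h).and hV).exists
  exact absurd hi (not_lt.2 hi')

/-- A bounded family in a proper space converges along every ultrafilter. -/
theorem exists_tendsto_ultrafilter [ProperSpace E] {ι : Type*} (l : Ultrafilter ι) {u : ι → E}
    {B : ℝ} (hu : ∀ᶠ i in (l : Filter ι), ‖u i‖ ≤ B) :
    ∃ y, Tendsto u l (𝓝 y) := by
  obtain ⟨y, -, hy⟩ := (isCompact_closedBall (0 : E) B).ultrafilter_le_nhds' (l.map u)
    (Ultrafilter.mem_map.2 (hu.mono fun i hi => by simpa using hi))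
  exact ⟨y, hy⟩

/-- **Helly's selection principle**, convergence part: convergence of functions and of their
variation functions at the rational points gives convergence almost everywhere. -/
theorem ae_cauchySeq_of_rat {f : ℕ → ℝ → E} {V : ℝ≥0∞} (hV : V ≠ ∞)
    (hfV : ∀ n, eVariationOn (f n) univ ≤ V) (hf : ∀ r : ℚ, CauchySeq fun n => f n r)
    (hv : ∀ r : ℚ, CauchySeq fun n => (eVariationOn (f n) (Iic (r : ℝ))).toReal) :
    ∀ᵐ x, CauchySeq fun n => f n x := by
  have hfin : ∀ n s, eVariationOn (f n) s ≠ ∞ := fun n s =>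
    ne_top_of_le_ne_top hV ((eVariationOn.mono _ (subset_univ s)).trans (hfV n))
  set v : ℕ → ℝ → ℝ := fun n x => (eVariationOn (f n) (Iic x)).toReal with hvdef
  have hvmono : ∀ n, Monotone (v n) := fun n x y hxy =>
    ENNReal.toReal_mono (hfin n _) (eVariationOn.mono _ (Iic_subset_Iic.2 hxy))
  have hvb : ∀ n x, ‖v n x‖ ≤ V.toReal := fun n x => by
    rw [Real.norm_of_nonneg ENNReal.toReal_nonneg]
    exact ENNReal.toReal_mono hV ((eVariationOn.mono _ (subset_univ _)).trans (hfV n))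
  -- An ultrafilter limit exists at every real point without further extraction. It is monotone,
  -- hence continuous off a countable set, and at rationals it is the genuine limit.
  choose W hW using fun x : ℝ => exists_tendsto_ultrafilter (hyperfilter ℕ)
    (u := fun n => v n x) (B := V.toReal) (Eventually.of_forall fun n => hvb n x)
  have hWmono : Monotone W := fun x y hxy =>
    le_of_tendsto_of_tendsto (hW x) (hW y) (Eventually.of_forall fun n => hvmono n hxy)
  have hWr : ∀ r : ℚ, Tendsto (fun n => v n r) atTop (𝓝 (W r)) := fun r => by
    obtain ⟨w, hw⟩ := cauchySeq_tendsto_of_complete (hv r)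
    have : Tendsto (fun n => v n r) (hyperfilter ℕ) (𝓝 w) :=
      hw.mono_left Nat.hyperfilter_le_atTop
    rwa [tendsto_nhds_unique (hW r) this]
  filter_upwards [hWmono.countable_not_continuousAt.ae_notMem volume] with x hx
  have hx : ContinuousAt W x := by simpa using hx
  rw [Metric.cauchySeq_iff']
  intro ε hε
  -- Two deviations of `ε / 8` keep `W q - W r` below `ε / 4`. For large `n` this bounds the
  -- variation of `f n` between `r` and `x`, so the Cauchy property at `r` carries over to `x`.
  obtain ⟨δ, hδ, hWδ⟩ := Metric.continuousAt_iff.1 hx (ε / 8) (by positivity)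
  obtain ⟨r, hr1, hr2⟩ := exists_rat_btwn (show x - δ < x by linarith)
  obtain ⟨q, hq1, hq2⟩ := exists_rat_btwn (show x < x + δ by linarith)
  have hr := hWδ (x := r) (by rw [Real.dist_eq, abs_lt]; constructor <;> linarith)
  have hq := hWδ (x := q) (by rw [Real.dist_eq, abs_lt]; constructor <;> linarith)
  rw [Real.dist_eq, abs_lt] at hr hq
  have hlim := (hWr q).sub (hWr r)
  have hev : ∀ᶠ n in atTop, v n q - v n r < ε / 4 :=
    hlim.eventually_lt_const (by linarith [hr.1, hq.2])
  obtain ⟨N₁, hN₁⟩ := eventually_atTop.1 hev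
  obtain ⟨N₂, hN₂⟩ := Metric.cauchySeq_iff'.1 (hf r) (ε / 4) (by positivity)
  have key : ∀ n ≥ N₁, dist (f n r) (f n x) ≤ ε / 4 := fun n hn => by
    have h1 := dist_le_variation_sub (hfin n univ) hr2.le
    have h2 : v n x ≤ v n q := hvmono n hq1.le
    have h3 := hN₁ n hn
    simp only [hvdef] at h1 h2 h3
    linarith
  refine ⟨max N₁ N₂, fun n hn => ?_⟩
  have h1 := key n (le_trans (le_max_left _ _) hn)
  have h2 := key (max N₁ N₂) (le_max_left _ _)
  have h3 := hN₂ n (le_trans (le_max_right _ _) hn)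
  have h4 := hN₂ (max N₁ N₂) (le_max_right _ _)
  rw [dist_comm] at h1
  rw [dist_comm] at h4
  have t1 := dist_triangle (f n x) (f n r) (f (max N₁ N₂) x)
  have t2 := dist_triangle (f n r) (f N₂ r) (f (max N₁ N₂) x)
  have t3 := dist_triangle (f N₂ r) (f (max N₁ N₂) r) (f (max N₁ N₂) x)
  linarith

/-- A bounded sequence of functions on a countable set, with values in a proper space, has a
pointwise convergent subsequence. -/
theorem exists_subseq_tendsto_countable {ι : Type*} [Countable ι] [ProperSpace E]
    {u : ℕ → ι → E} {B : ℝ} (hu : ∀ n i, ‖u n i‖ ≤ B) :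
    ∃ φ : ℕ → ℕ, StrictMono φ ∧ ∀ i, CauchySeq fun n => u (φ n) i := by
  obtain ⟨a, -, φ, hφ, ha⟩ := (isCompact_univ_pi fun _ : ι => isCompact_closedBall (0 : E) B)
    |>.tendsto_subseq (x := u) fun n => by simpa [Set.mem_pi] using hu n
  exact ⟨φ, hφ, fun i => (tendsto_pi_nhds.1 ha i).cauchySeq⟩

end Helly

/-! ### Estimates in `L¹` and `L²`. -/

section L1

variable {E : Type*} [NormedAddCommGroup E]

theorem eLpNorm_sub_triangle {α : Type*} [MeasurableSpace α] {μ : Measure α} {p : ℝ≥0∞}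
    (hp : 1 ≤ p) {f g h : α → E}
    (hf : AEStronglyMeasurable f μ) (hg : AEStronglyMeasurable g μ)
    (hh : AEStronglyMeasurable h μ) :
    eLpNorm (fun x => f x - h x) p μ ≤
      eLpNorm (fun x => f x - g x) p μ + eLpNorm (fun x => g x - h x) p μ := by
  have h1 : (fun x => f x - h x) = (fun x => f x - g x) + fun x => g x - h x := by
    ext x; simp
  rw [h1]
  exact eLpNorm_add_le (hf.sub hg) (hg.sub hh) hp

theorem eLpNorm_sub_comm' {α : Type*} [MeasurableSpace α] {μ : Measure α} {p : ℝ≥0∞}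
    {f g : α → E} :
    eLpNorm (fun x => f x - g x) p μ = eLpNorm (fun x => g x - f x) p μ :=
  eLpNorm_sub_comm f g p μ

/-- Interpolation between `L¹` and `L^∞`. -/
theorem eLpNorm_two_le {α : Type*} [MeasurableSpace α] {μ : Measure α} {f : α → E}
    {K : ℝ} (hK : ∀ᵐ x ∂μ, ‖f x‖ ≤ K) :
    eLpNorm f 2 μ ≤ (ENNReal.ofReal K * eLpNorm f 1 μ) ^ (1 / 2 : ℝ) := by
  rw [eLpNorm_eq_lintegral_rpow_enorm_toReal (by simp) (by simp), eLpNorm_one_eq_lintegral_enorm,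
    ← lintegral_const_mul' _ _ ENNReal.ofReal_ne_top]
  refine ENNReal.rpow_le_rpow (lintegral_mono_ae ?_) (by norm_num)
  filter_upwards [hK] with x hx
  have : ‖f x‖ₑ ≤ ENNReal.ofReal K := by
    rw [← ofReal_norm]; exact ENNReal.ofReal_le_ofReal hx
  calc ‖f x‖ₑ ^ (2 : ℝ≥0∞).toReal = ‖f x‖ₑ * ‖f x‖ₑ := by norm_num [sq]
    _ ≤ _ := by gcongr

instance (R : ℝ) : IsFiniteMeasure (interval R) := by
  unfold interval; infer_instance

theorem interval_le (R : ℝ) : interval R ≤ volume := Measure.restrict_le_self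

theorem interval_mono {R S : ℝ} (h : R ≤ S) : interval R ≤ interval S :=
  Measure.restrict_mono (Ioo_subset_Ioo (by linarith) h) le_rfl

/-- Dominated convergence: a bounded sequence which is almost everywhere Cauchy is Cauchy in `L¹` of
a finite measure. -/
theorem eventually_eLpNorm_sub_le [CompleteSpace E] {α : Type*} [MeasurableSpace α] {μ : Measure α}
    [IsFiniteMeasure μ] {f : ℕ → α → E} {B : ℝ} (hfm : ∀ n, AEStronglyMeasurable (f n) μ)
    (hB : ∀ n x, ‖f n x‖ ≤ B) (hf : ∀ᵐ x ∂μ, CauchySeq fun n => f n x) {ε : ℝ≥0∞} (hε : 0 < ε) :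
    ∃ N, ∀ n ≥ N, ∀ m ≥ N, eLpNorm (fun x => f n x - f m x) 1 μ ≤ ε := by
  classical
  have hex : ∀ᵐ x ∂μ, ∃ l, Tendsto (fun n => f n x) atTop (𝓝 l) := by
    filter_upwards [hf] with x hx using cauchySeq_tendsto_of_complete hx
  obtain ⟨g, hgm, hg⟩ := exists_stronglyMeasurable_limit_of_tendsto_ae hfm hex
  have h := tendsto_lintegral_norm_of_dominated_convergence hfm
    (bound := fun _ => B) (hasFiniteIntegral_const B)
    (fun n => Eventually.of_forall (hB n)) hg
  have hε2 : 0 < ε / 2 := ENNReal.half_pos hε.ne'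
  obtain ⟨N, hN⟩ := eventually_atTop.1 (h.eventually_le_const hε2)
  have hN' : ∀ n ≥ N, eLpNorm (fun x => f n x - g x) 1 μ ≤ ε / 2 := fun n hn => by
    rw [eLpNorm_one_eq_lintegral_enorm]
    simpa only [ofReal_norm] using hN n hn
  refine ⟨N, fun n hn m hm => ?_⟩
  calc _ ≤ _ := eLpNorm_sub_triangle le_rfl (hfm n) hgm.aestronglyMeasurable (hfm m)
    _ ≤ ε / 2 + ε / 2 := by
      refine add_le_add (hN' n hn) ?_
      rw [eLpNorm_sub_comm']
      exact hN' m hm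
    _ = ε := ENNReal.add_halves ε

end L1

end SpaceLike

namespace SpaceLike

/-! ### Compactness, uniformly on bounded time intervals. -/

section Compactness

variable {E : Type*} [NormedAddCommGroup E]

/-- Compactness in `L¹`, uniformly on bounded time intervals, of sequences of functions which are
bounded, of uniformly bounded variation in space and Lipschitz in time. -/
theorem exists_subseq_uniform_cauchy [ProperSpace E] {f : ℕ → ℝ → ℝ → E} {V : ℝ≥0∞} {B C : ℝ}
    (hm : ∀ n t, AEStronglyMeasurable (f n t) volume) (hV : V ≠ ∞)
    (hfV : ∀ n t, eVariationOn (f n t) univ ≤ V) (hB : ∀ n t x, ‖f n t x‖ ≤ B) (hC : 0 < C)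
    (hL : ∀ n s t, eLpNorm (fun x => f n t x - f n s x) 1 volume ≤ ENNReal.ofReal (C * |t - s|)) :
    ∃ φ : ℕ → ℕ, StrictMono φ ∧ ∀ n : ℕ, ∀ m ≥ n, ∀ t : ℝ, |t| ≤ n →
      eLpNorm (fun x => f (φ n) t x - f (φ m) t x) 1 (interval n) ≤ 2⁻¹ ^ n := by
  obtain ⟨φ₁, hφ₁, hcau⟩ := exists_subseq_tendsto_countable (ι := ℚ × ℚ) (E := E × ℝ)
    (u := fun n i => (f n i.1 i.2, (eVariationOn (f n i.1) (Iic (i.2 : ℝ))).toReal))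
    (B := max B V.toReal) fun n i => by
      rw [Prod.norm_mk, Real.norm_of_nonneg ENNReal.toReal_nonneg]
      exact max_le_max (hB _ _ _)
        (ENNReal.toReal_mono hV ((eVariationOn.mono _ (subset_univ _)).trans (hfV _ _)))
  have hrat : ∀ q : ℚ, ∀ᵐ x, CauchySeq fun n => f (φ₁ n) q x := fun q =>
    ae_cauchySeq_of_rat hV (fun n => hfV _ _)
      (fun r => uniformContinuous_fst.comp_cauchySeq (hcau (q, r)))
      (fun r => uniformContinuous_snd.comp_cauchySeq (hcau (q, r)))
  have hmi : ∀ n t (R : ℝ), AEStronglyMeasurable (f n t) (interval R) := fun n t R =>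
    (hm n t).mono_measure (interval_le R)
  have hunif : ∀ k : ℕ, ∃ N, ∀ j ≥ N, ∀ n ≥ j, ∀ m ≥ j, ∀ t : ℝ, |t| ≤ k →
      eLpNorm (fun x => f (φ₁ n) t x - f (φ₁ m) t x) 1 (interval k) ≤ 2⁻¹ ^ k := by
    intro k
    set ε : ℝ := 2⁻¹ ^ k with hε
    have hεpos : 0 < ε := by positivity
    -- Moving to a rational time within `δ` costs `C * δ = ε / 4`, and this happens twice; the
    -- remaining `ε / 2` is for the Cauchy error at finitely many rational times.
    set δ : ℝ := ε / (4 * C) with hδ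
    have hδpos : 0 < δ := by positivity
    obtain ⟨S, hS⟩ := (isCompact_Icc (a := -(k : ℝ)) (b := k)).elim_finite_subcover
      (fun q : ℚ => Metric.ball (q : ℝ) δ) (fun q => Metric.isOpen_ball) (fun t _ => by
        obtain ⟨q, hq1, hq2⟩ := exists_rat_btwn (show t < t + δ by linarith)
        refine mem_iUnion.2 ⟨q, ?_⟩
        rw [Metric.mem_ball, Real.dist_eq, abs_lt]
        constructor <;> linarith)
    choose N hN using fun q : ℚ => eventually_eLpNorm_sub_le (μ := interval k)
      (fun n => hmi (φ₁ n) q k) (fun n x => hB (φ₁ n) q x) (ae_mono (interval_le _) (hrat q))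
      (ε := ENNReal.ofReal (ε / 2)) (by simpa using hεpos)
    refine ⟨S.sup N, fun j hj n hn m hm' t ht => ?_⟩
    obtain ⟨q, hqS, hq⟩ := mem_iUnion₂.1 (hS (abs_le.1 ht))
    rw [Metric.mem_ball, Real.dist_eq] at hq
    have hNj : N q ≤ j := (Finset.le_sup hqS).trans hj
    have hLip : ∀ n s t, |t - s| < δ →
        eLpNorm (fun x => f n t x - f n s x) 1 (interval k) ≤ ENNReal.ofReal (ε / 4) := by
      intro n s t hst
      refine (eLpNorm_mono_measure _ (interval_le _)).trans ((hL n s t).trans ?_)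
      refine ENNReal.ofReal_le_ofReal ?_
      calc C * |t - s| ≤ C * δ := by gcongr
        _ = ε / 4 := by rw [hδ]; field_simp
    have h1 := hLip (φ₁ n) q t hq
    have h2 := hLip (φ₁ m) t q (by rwa [abs_sub_comm])
    have h3 := hN q n (hNj.trans hn) m (hNj.trans hm')
    calc eLpNorm (fun x => f (φ₁ n) t x - f (φ₁ m) t x) 1 (interval k)
        ≤ eLpNorm (fun x => f (φ₁ n) t x - f (φ₁ n) q x) 1 (interval k)
          + (eLpNorm (fun x => f (φ₁ n) q x - f (φ₁ m) q x) 1 (interval k)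
            + eLpNorm (fun x => f (φ₁ m) q x - f (φ₁ m) t x) 1 (interval k)) := by
          exact (eLpNorm_sub_triangle le_rfl (hmi (φ₁ n) t k) (hmi (φ₁ n) q k)
            (hmi (φ₁ m) t k)).trans (add_le_add_right (eLpNorm_sub_triangle le_rfl
              (hmi (φ₁ n) q k) (hmi (φ₁ m) q k) (hmi (φ₁ m) t k)) _)
      _ ≤ ENNReal.ofReal (ε / 4) + (ENNReal.ofReal (ε / 2) + ENNReal.ofReal (ε / 4)) := by
          gcongr
      _ = ENNReal.ofReal ε := by
          rw [← ENNReal.ofReal_add (by positivity) (by positivity),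
            ← ENNReal.ofReal_add (by positivity) (by positivity)]
          congr 1; ring
      _ = 2⁻¹ ^ k := by
          rw [hε, ENNReal.ofReal_pow (by norm_num), ENNReal.ofReal_inv_of_pos (by norm_num)]
          norm_num
  obtain ⟨φ₂, hφ₂, h⟩ := extraction_forall_of_eventually' hunif
  exact ⟨φ₁ ∘ φ₂, hφ₁.comp hφ₂, fun n m hnm t ht =>
    h n (φ₂ n) le_rfl (φ₂ m) (hφ₂.monotone hnm) t ht⟩

/-- A property which holds almost everywhere on large intervals holds almost everywhere. -/
theorem ae_of_forall_interval {p : ℝ → Prop} (K : ℕ)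
    (h : ∀ k : ℕ, K ≤ k → ∀ᵐ x ∂(interval k), p x) : ∀ᵐ x, p x := by
  have h' : ∀ᵐ x, ∀ k : ℕ, K ≤ k → x ∈ Ioo (-(k : ℝ)) k → p x := by
    simp only [ae_all_iff]
    intro k hk
    exact (ae_restrict_iff' measurableSet_Ioo).1 (h k hk)
  filter_upwards [h'] with x hx
  obtain ⟨k, hk⟩ := exists_nat_gt (max |x| K)
  have h1 := (le_max_left _ _).trans_lt hk
  have h2 : (K : ℝ) < k := (le_max_right _ _).trans_lt hk
  exact hx k (by exact_mod_cast h2.le) (abs_lt.1 h1)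

/-- Summable `L¹` errors give convergence almost everywhere. -/
theorem ae_tendsto_of_tsum_eLpNorm {α : Type*} [MeasurableSpace α] {μ : Measure α}
    {f : ℕ → α → E} {g : α → E} (hf : ∀ n, AEStronglyMeasurable (fun x => f n x - g x) μ)
    {b : ℕ → ℝ≥0∞} (hb : ∑' n, b n ≠ ∞) (h : ∀ n, eLpNorm (fun x => f n x - g x) 1 μ ≤ b n) :
    ∀ᵐ x ∂μ, Tendsto (fun n => f n x) atTop (𝓝 (g x)) := by
  have h1 : ∫⁻ x, ∑' n, ‖f n x - g x‖ₑ ∂μ ≠ ∞ := by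
    rw [lintegral_tsum fun n => (hf n).enorm]
    refine ne_top_of_le_ne_top hb (ENNReal.tsum_le_tsum fun n => ?_)
    rw [← eLpNorm_one_eq_lintegral_enorm]
    exact h n
  filter_upwards [ae_lt_top' (AEMeasurable.tsum fun n => (hf n).enorm) h1] with x hx
  have h2 := ENNReal.tendsto_atTop_zero_of_tsum_ne_top hx.ne
  rw [tendsto_iff_edist_tendsto_0]
  simpa only [edist_eq_enorm_sub] using h2

theorem tsum_half_ne_top (c : ℝ≥0∞) (hc : c ≠ ∞) : ∑' n : ℕ, c * (2⁻¹ : ℝ≥0∞) ^ n ≠ ∞ := by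
  rw [ENNReal.tsum_mul_left, ENNReal.tsum_geometric, ENNReal.one_sub_inv_two, inv_inv]
  exact ENNReal.mul_ne_top hc (by simp)

variable [NormedSpace ℝ E] [FiniteDimensional ℝ E]

/-- A function of bounded variation agrees almost everywhere with its right limits. -/
theorem rightLim_ae_eq {g : ℝ → E} (hg : BoundedVariationOn g univ) :
    Function.rightLim g =ᵐ[volume] g := by
  filter_upwards [hg.locallyBoundedVariationOn.ae_differentiableAt] with x hx
  exact hx.continuousAt.continuousWithinAt.rightLim_eq

/-- Compactness with a right-continuous limit. -/
theorem exists_subseq_limit {f : ℕ → ℝ → ℝ → E} {V : ℝ≥0∞} {B C : ℝ}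
    (hm : ∀ n t, AEStronglyMeasurable (f n t) volume) (hV : V ≠ ∞)
    (hfV : ∀ n t, eVariationOn (f n t) univ ≤ V) (hB : ∀ n t x, ‖f n t x‖ ≤ B) (hC : 0 < C)
    (hL : ∀ n s t, eLpNorm (fun x => f n t x - f n s x) 1 volume ≤ ENNReal.ofReal (C * |t - s|)) :
    ∃ (φ : ℕ → ℕ) (ψ : ℝ → ℝ → E), StrictMono φ ∧
      (∀ t x, ContinuousWithinAt (ψ t) (Ici x) x) ∧ (∀ t x, ‖ψ t x‖ ≤ B) ∧
      (∀ t, ∀ᵐ x, Tendsto (fun n => f (φ n) t x) atTop (𝓝 (ψ t x))) ∧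
      ∀ n : ℕ, ∀ t : ℝ, |t| ≤ n →
        eLpNorm (fun x => f (φ n) t x - ψ t x) 1 (interval n) ≤ 2⁻¹ ^ n := by
  have : ProperSpace E := FiniteDimensional.proper ℝ E
  have : CompleteSpace E := FiniteDimensional.complete ℝ E
  obtain ⟨φ, hφ, hcau⟩ := exists_subseq_uniform_cauchy hm hV hfV hB hC hL
  have hmi : ∀ n t (R : ℝ), AEStronglyMeasurable (f n t) (interval R) := fun n t R =>
    (hm n t).mono_measure (interval_le R)
  have hex : ∀ t, ∀ᵐ x, ∃ l, Tendsto (fun n => f (φ n) t x) atTop (𝓝 l) := by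
    intro t
    obtain ⟨K, hK⟩ := exists_nat_ge |t|
    refine ae_of_forall_interval K fun k hk => ?_
    -- The index is shifted by `k` so that the fast estimate covers both the time `t` and the
    -- interval of radius `k`. Two errors sum to `2 * 2⁻¹ ^ N`; the factor `3` makes the inequality
    -- strict.
    have := Lp.ae_tendsto_of_cauchy_eLpNorm (μ := interval k) (p := 1)
      (f := fun n => f (φ (n + k)) t) (fun n => hmi _ _ _) le_rfl
      (B := fun n => 3 * 2⁻¹ ^ n) (tsum_half_ne_top 3 (by simp)) (fun N n m hn hm' => by
        have hkt : |t| ≤ ((N + k : ℕ) : ℝ) := by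
          refine hK.trans ?_
          exact_mod_cast hk.trans (Nat.le_add_left _ _)
        have hint : interval (k : ℝ) ≤ interval ((N + k : ℕ) : ℝ) :=
          interval_mono (by push_cast; linarith [(Nat.cast_nonneg N : (0 : ℝ) ≤ N)])
        have hp : (2⁻¹ : ℝ≥0∞) ^ (N + k) ≤ 2⁻¹ ^ N :=
          pow_le_pow_right_of_le_one' (by simp) (Nat.le_add_right _ _)
        have h1 : ∀ n ≥ N, eLpNorm (fun x => f (φ (N + k)) t x - f (φ (n + k)) t x) 1
            (interval k) ≤ 2⁻¹ ^ N := fun n hn =>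
          ((eLpNorm_mono_measure _ hint).trans
            (hcau (N + k) (n + k) (Nat.add_le_add_right hn k) t hkt)).trans hp
        have h2 : eLpNorm (fun x => f (φ (n + k)) t x - f (φ (N + k)) t x) 1
            (interval k) ≤ 2⁻¹ ^ N := by
          rw [eLpNorm_sub_comm']
          exact h1 n hn
        have h3 := (eLpNorm_sub_triangle le_rfl (hmi (φ (n + k)) t k) (hmi (φ (N + k)) t k)
          (hmi (φ (m + k)) t k)).trans (add_le_add h2 (h1 m hm'))
        refine lt_of_le_of_lt h3 ?_
        rw [← two_mul]
        exact ENNReal.mul_lt_mul_left (pow_ne_zero _ (by simp)) (ENNReal.pow_ne_top (by simp))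
          (by norm_num))
    filter_upwards [this] with x ⟨l, hl⟩
    exact ⟨l, (tendsto_add_atTop_iff_nat k).1 hl⟩
  -- A limit defined at every point is needed, since pointwise variation bounds do not survive
  -- changes on null sets. Its right limits then exist everywhere.
  choose g hg using fun t x => exists_tendsto_ultrafilter (hyperfilter ℕ)
    (u := fun n => f (φ n) t x) (B := B) (Eventually.of_forall fun n => hB _ _ _)
  have hgV : ∀ t, BoundedVariationOn (g t) univ := fun t =>
    ne_top_of_le_ne_top hV (eVariationOn_le_of_tendsto (fun x _ => hg t x)
      (Eventually.of_forall fun n => hfV _ _))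
  have hgB : ∀ t x, ‖g t x‖ ≤ B := fun t x =>
    le_of_tendsto (hg t x).norm (Eventually.of_forall fun n => hB _ _ _)
  have hlim : ∀ t, ∀ᵐ x, Tendsto (fun n => f (φ n) t x) atTop
      (𝓝 (Function.rightLim (g t) x)) := by
    intro t
    filter_upwards [hex t, rightLim_ae_eq (hgV t)] with x ⟨l, hl⟩ hx
    rw [hx, tendsto_nhds_unique (hg t x) (hl.mono_left Nat.hyperfilter_le_atTop)]
    exact hl
  refine ⟨φ, fun t => Function.rightLim (g t), hφ,
    fun t x => (hgV t).continuousWithinAt_rightLim,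
    fun t x => le_of_tendsto ((hgV t).tendsto_rightLim x).norm
      (Eventually.of_forall fun y => hgB t y), hlim, fun n t ht => ?_⟩
  -- Fatou's lemma in `m`, with `n` fixed.
  refine (Lp.eLpNorm_lim_le_liminf_eLpNorm (f := fun m x => f (φ n) t x - f (φ m) t x)
    (fun m => (hmi _ _ _).sub (hmi _ _ _)) _ ?_).trans ?_
  · filter_upwards [ae_mono (interval_le _) (hlim t)] with x hx using tendsto_const_nhds.sub hx
  · exact liminf_le_of_frequently_le'
      ((eventually_ge_atTop n).mono fun m hm' => hcau n m hm' t ht).frequently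

end Compactness

/-! ### Joint measurability and almost everywhere convergence on products. -/

section JointMeasurability

variable {E : Type*} [NormedAddCommGroup E]

/-- A function which is right-continuous in space and Lipschitz in time with values in `L¹` is
jointly measurable: it is a limit of differences of its (continuous) primitives. -/
theorem stronglyMeasurable_uncurry_of_rightContinuous [NormedSpace ℝ E] [CompleteSpace E]
    {ψ : ℝ → ℝ → E} {B C : ℝ}
    (hr : ∀ t x, ContinuousWithinAt (ψ t) (Ici x) x) (hB : ∀ t x, ‖ψ t x‖ ≤ B)
    (hm : ∀ t, AEStronglyMeasurable (ψ t) volume) (hC : 0 < C)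
    (hL : ∀ s t, eLpNorm (fun x => ψ t x - ψ s x) 1 volume ≤ ENNReal.ofReal (C * |t - s|)) :
    StronglyMeasurable (Function.uncurry ψ) := by
  have hint : ∀ t a b, IntervalIntegrable (ψ t) volume a b := fun t a b =>
    intervalIntegrable_const (c := B) |>.mono_fun' (hm t).restrict
      (Eventually.of_forall fun x => hB t x)
  have hsub : ∀ s t, Integrable (fun x => ψ t x - ψ s x) volume := fun s t =>
    memLp_one_iff_integrable.1 ⟨(hm t).sub (hm s), (hL s t).trans_lt ENNReal.ofReal_lt_top⟩
  set F : ℝ → ℝ → E := fun t x => ∫ y in (0 : ℝ)..x, ψ t y with hF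
  have hFx : ∀ t, Continuous (F t) := fun t =>
    intervalIntegral.continuous_primitive (hint t) 0
  have hFt : ∀ x, Continuous fun t => F t x := by
    intro x
    have : LipschitzWith (Real.toNNReal C) fun t => F t x := by
      refine LipschitzWith.of_dist_le_mul fun t s => ?_
      rw [dist_eq_norm, Real.coe_toNNReal _ hC.le, Real.dist_eq, hF]
      simp only
      rw [← intervalIntegral.integral_sub (hint t 0 x) (hint s 0 x)]
      refine (intervalIntegral.norm_integral_le_integral_norm_uIoc).trans ?_
      refine (setIntegral_le_integral (hsub s t).norm
        (Eventually.of_forall fun y => norm_nonneg _)).trans ?_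
      rw [integral_norm_eq_lintegral_enorm (hsub s t).1, ← eLpNorm_one_eq_lintegral_enorm]
      exact ENNReal.toReal_le_of_le_ofReal (by positivity) (hL s t)
    exact this.continuous
  have hmeas : ∀ h : ℝ, StronglyMeasurable (Function.uncurry fun t x => F t (x + h)) := fun h =>
    stronglyMeasurable_uncurry_of_continuous_of_stronglyMeasurable
      (fun x => hFt (x + h))
      (fun t => ((hFx t).comp (continuous_id.add continuous_const)).stronglyMeasurable)
  refine stronglyMeasurable_of_tendsto atTop
    (f := fun (k : ℕ) (p : ℝ × ℝ) => ((1 / ((k : ℝ) + 1))⁻¹ : ℝ) •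
      (F p.1 (p.2 + 1 / ((k : ℝ) + 1)) - F p.1 (p.2 + 0)))
    (fun k => ((hmeas (1 / ((k : ℝ) + 1))).sub (hmeas 0)).const_smul _) ?_
  rw [tendsto_pi_nhds]
  rintro ⟨t, x⟩
  -- By right-continuity the right derivative of the primitive is the value of `ψ` at every point,
  -- not just almost every one.
  have hder : HasDerivWithinAt (F t) (ψ t x) (Ici x) x :=
    intervalIntegral.integral_hasDerivWithinAt_right (hint t 0 x)
      (t := Ioi x) ⟨univ, univ_mem, (hm t).restrict⟩ ((hr t x).mono Ioi_subset_Ici_self)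
  rw [hasDerivWithinAt_iff_tendsto_slope, Ici_sdiff_left] at hder
  have hseq : Tendsto (fun k : ℕ => x + 1 / ((k : ℝ) + 1)) atTop (𝓝[>] x) := by
    refine tendsto_nhdsWithin_iff.2 ⟨?_, Eventually.of_forall fun k => ?_⟩
    · simpa using (tendsto_one_div_add_atTop_nhds_zero_nat (𝕜 := ℝ)).const_add x
    · have : (0 : ℝ) < 1 / ((k : ℝ) + 1) := by positivity
      simpa using this
  have := hder.comp hseq
  simpa [slope_def_module, Function.comp_def] using this

/-- Convergence almost everywhere on almost every slice gives convergence almost everywhere. -/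
theorem ae_prod_tendsto {α β : Type*} [MeasurableSpace α] [MeasurableSpace β] {μ : Measure α}
    {ν : Measure β} [SFinite μ] [SFinite ν] {f : ℕ → α × β → E} {g : α × β → E}
    (hf : ∀ n, AEStronglyMeasurable (f n) (μ.prod ν)) (hg : AEStronglyMeasurable g (μ.prod ν))
    (h : ∀ᵐ a ∂μ, ∀ᵐ b ∂ν, Tendsto (fun n => f n (a, b)) atTop (𝓝 (g (a, b)))) :
    ∀ᵐ p ∂(μ.prod ν), Tendsto (fun n => f n p) atTop (𝓝 (g p)) := by
  have heq : ∀ᵐ p ∂(μ.prod ν), g p = hg.mk g p ∧ ∀ n, f n p = (hf n).mk (f n) p :=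
    hg.ae_eq_mk.and (ae_all_iff.2 fun n => (hf n).ae_eq_mk)
  have hS : MeasurableSet {p | Tendsto (fun n => ‖(hf n).mk (f n) p - hg.mk g p‖) atTop (𝓝 0)} :=
    measurableSet_tendsto (𝓝 0) fun n =>
      ((hf n).stronglyMeasurable_mk.sub hg.stronglyMeasurable_mk).norm.measurable
  have hae : ∀ᵐ p ∂(μ.prod ν),
      p ∈ {p | Tendsto (fun n => ‖(hf n).mk (f n) p - hg.mk g p‖) atTop (𝓝 0)} := by
    rw [Measure.ae_prod_mem_iff_ae_ae_mem hS]
    filter_upwards [Measure.ae_ae_of_ae_prod heq, h] with a ha ha'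
    filter_upwards [ha, ha'] with b hb hb'
    refine tendsto_iff_norm_sub_tendsto_zero.1 ?_
    simpa only [← hb.1, ← hb.2] using hb'
  filter_upwards [heq, hae] with p hp hp'
  replace hp' := tendsto_iff_norm_sub_tendsto_zero.2 hp'
  simpa only [hp.1, hp.2] using hp'

end JointMeasurability

end SpaceLike

namespace SpaceLike

/-! ### Measurability of piecewise constant functions. -/

section Fronts

variable {d : ℕ} {u : ℝ → ℝ → State d}

theorem halfPlane_eq_prod :
    halfPlane = ((volume : Measure ℝ).restrict (Ici 0)).prod volume := by
  rw [halfPlane, Measure.volume_eq_prod, ← Measure.prod_restrict, Measure.restrict_univ]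

/-- Off countably many points of a line `t = const`, a piecewise constant function is locally
constant, both along the line and in time. -/
theorem IsPiecewiseConstant.countable_fronts (hu : IsPiecewiseConstant u) {t : ℝ} (ht : 0 ≤ t) :
    {x | ¬((∀ᶠ y in 𝓝 x, u t y = u t x) ∧ ∀ᶠ s in 𝓝[Ici 0] t, u s x = u t x)}.Countable := by
  obtain ⟨Γ, -, hfin, hloc⟩ := hu
  have hc : (⋃ k : ℕ, {x : ℝ | x ∈ Icc (-(k : ℝ)) k ∧ (t, x) ∈ Γ}).Countable :=
    countable_iUnion fun k => (hfin t ht k).countable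
  refine hc.mono fun x hx => ?_
  obtain ⟨k, hk⟩ := exists_nat_ge |x|
  refine mem_iUnion.2 ⟨k, abs_le.1 hk, ?_⟩
  by_contra hΓ
  have h := hloc (t, x) ht hΓ
  refine hx ⟨?_, ?_⟩
  · have hc : Tendsto (fun y : ℝ => (t, y)) (𝓝 x) (𝓝[Ici (0 : ℝ) ×ˢ (univ : Set ℝ)] (t, x)) :=
      tendsto_nhdsWithin_iff.2 ⟨Continuous.tendsto (by fun_prop) x,
        Eventually.of_forall fun y => ⟨ht, mem_univ _⟩⟩
    exact hc.eventually h
  · have hc : Tendsto (fun s : ℝ => (s, x)) (𝓝[Ici 0] t)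
        (𝓝[Ici (0 : ℝ) ×ˢ (univ : Set ℝ)] (t, x)) := by
      refine tendsto_nhdsWithin_iff.2 ⟨?_, ?_⟩
      · exact (Continuous.tendsto (by fun_prop) t).mono_left nhdsWithin_le_nhds
      · filter_upwards [self_mem_nhdsWithin] with s hs using ⟨hs, mem_univ _⟩
    exact hc.eventually h

theorem IsPiecewiseConstant.ae_eventually_eq (hu : IsPiecewiseConstant u) {t : ℝ} (ht : 0 ≤ t) :
    ∀ᵐ x, ∀ᶠ s in 𝓝[Ici 0] t, u s x = u t x := by
  filter_upwards [(hu.countable_fronts ht).ae_notMem volume] with x hx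
  exact (not_not.1 hx).2

theorem IsPiecewiseConstant.aestronglyMeasurable_slice (hu : IsPiecewiseConstant u) {t : ℝ}
    (ht : 0 ≤ t) : AEStronglyMeasurable (u t) volume := by
  have hc : {x | ¬ContinuousAt (u t) x}.Countable := by
    refine (hu.countable_fronts ht).mono fun x hx => ?_
    rw [mem_ofPred_eq] at hx ⊢
    exact fun h => hx ((continuousAt_const (y := u t x)).congr (h.1.mono fun y hy => hy.symm))
  exact (StronglyMeasurable.of_countable_not_continuousAt hc).aestronglyMeasurable

/-- The closed front set has countable slices, so it is null by Fubini; off it the function is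
continuous relative to the half plane. -/
theorem IsPiecewiseConstant.aestronglyMeasurable (hu : IsPiecewiseConstant u) :
    AEStronglyMeasurable (fun p : ℝ × ℝ => u p.1 p.2) halfPlane := by
  obtain ⟨Γ, hΓ, hfin, hloc⟩ := hu
  have hnull : ∀ᵐ p ∂halfPlane, p ∈ Γᶜ := by
    rw [halfPlane_eq_prod, Measure.ae_prod_mem_iff_ae_ae_mem hΓ.measurableSet.compl]
    filter_upwards [ae_restrict_mem measurableSet_Ici] with t ht
    have hc : (⋃ k : ℕ, {x : ℝ | x ∈ Icc (-(k : ℝ)) k ∧ (t, x) ∈ Γ}).Countable :=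
      countable_iUnion fun k => (hfin t ht k).countable
    filter_upwards [hc.ae_notMem volume] with x hx hxΓ
    obtain ⟨k, hk⟩ := exists_nat_ge |x|
    exact hx (mem_iUnion.2 ⟨k, abs_le.1 hk, hxΓ⟩)
  have hmeas : MeasurableSet ((Ici (0 : ℝ) ×ˢ (univ : Set ℝ)) ∩ Γᶜ) :=
    (measurableSet_Ici.prod MeasurableSet.univ).inter hΓ.measurableSet.compl
  have hmem : ∀ᵐ p ∂halfPlane, p ∈ (Ici (0 : ℝ) ×ˢ (univ : Set ℝ)) ∩ Γᶜ :=
    (ae_restrict_mem (measurableSet_Ici.prod MeasurableSet.univ)).and hnull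
  have hcont : ContinuousOn (fun p : ℝ × ℝ => u p.1 p.2)
      ((Ici (0 : ℝ) ×ˢ (univ : Set ℝ)) ∩ Γᶜ) := fun p hp =>
    (tendsto_const_nhds.congr' ((hloc p hp.1.1 hp.2).mono fun q hq => hq.symm)).mono_left
      (nhdsWithin_mono _ inter_subset_left)
  rw [← Measure.restrict_eq_self_of_ae_mem hmem]
  exact hcont.aestronglyMeasurable hmeas

end Fronts

/-! ### Bounds along space-like curves from Condition H. -/

section Variation

variable {d : ℕ} {u : ℝ → ℝ → State d} {lam C M : ℝ}

theorem exists_mem_Ioo_of_ae {p : ℝ → Prop} (h : ∀ᵐ x, p x) {a b : ℝ} (hab : a < b) :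
    ∃ x ∈ Ioo a b, p x := by
  by_contra! hne
  have h0 : volume (Ioo a b) = 0 := measure_mono_null (fun x hx => hne x hx) (ae_iff.1 h)
  rw [Real.volume_Ioo, ENNReal.ofReal_eq_zero] at h0
  linarith

theorem LInftyBVBound.exists_mem_Ioo (hM : LInftyBVBound M u) {a b : ℝ} (ha : 0 ≤ a) (hab : a < b) :
    ∃ s ∈ Ioo a b, bvNorm (u s) ≤ ENNReal.ofReal M := by
  obtain ⟨s, hs, h⟩ := exists_mem_Ioo_of_ae ((ae_restrict_iff' measurableSet_Ici).1 hM) hab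
  exact ⟨s, hs, h (ha.trans hs.1.le)⟩

/-- A space-like curve which lies above a line `t = s` on which `u` is controlled is dominated by a
long segment of that line. -/
theorem ConditionH.totVar_le (hlam : 0 < lam) (hH : ConditionH lam C u) {s : ℝ} (hs : 0 ≤ s)
    (hM : bvNorm (u s) ≤ ENNReal.ofReal M) {γ : ℝ → ℝ} {a b : ℝ} (hab : a < b)
    (hγ : IsSpaceLike lam γ a b) (hsγ : ∀ x ∈ Icc a b, s ≤ γ x) :
    totVar u γ a b ≤ ENNReal.ofReal C * ENNReal.ofReal M := by
  -- `K` bounds the height of the curve. Widening the base by `lam * K` on each side raises both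
  -- boundary lines of its domain of dependence above `K` over `(a, b)`.
  set K : ℝ := γ a + (b - a) / lam with hK
  have ha : a ∈ Icc a b := left_mem_Icc.2 hab.le
  have hba : 0 < (b - a) / lam := div_pos (sub_pos.2 hab) hlam
  have hK0 : 0 ≤ K := add_nonneg (hγ.1 a ha) hba.le
  have hγK : ∀ x ∈ Icc a b, γ x ≤ K := by
    intro x hx
    rcases hx.1.eq_or_lt with rfl | hax
    · linarith
    · have h1 := (abs_lt.1 (hγ.2 a ha x hx hax)).2
      have h2 : (x - a) / lam ≤ (b - a) / lam := by gcongr; exact hx.2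
      linarith
  have hline : IsSpaceLike lam (fun _ => s) (a - lam * K) (b + lam * K) :=
    ⟨fun _ _ => hs, fun x₁ _ x₂ _ h => by simpa using div_pos (sub_pos.2 h) hlam⟩
  have hlK : 0 ≤ lam * K := by positivity
  have hdom : Dominates lam (fun _ => s) (a - lam * K) (b + lam * K) γ a b := by
    refine ⟨by linarith, hab, by linarith, fun x hx => ?_⟩
    have hx' := Ioo_subset_Icc_self hx
    refine ⟨hsγ x hx', (hγK x hx').trans (le_min ?_ ?_)⟩
    · have : K ≤ (x - (a - lam * K)) / lam := by
        rw [le_div_iff₀ hlam]; linarith [hx.1]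
      linarith
    · have : K ≤ (b + lam * K - x) / lam := by
        rw [le_div_iff₀ hlam]; linarith [hx.2]
      linarith
  refine (hH _ _ _ _ _ _ hline hγ hdom).trans ?_
  gcongr
  exact (eVariationOn.mono _ (subset_univ _)).trans (le_add_self.trans hM)

/-- Variation of `u` along translates of a space-like curve, upwards in time and in space. -/
theorem ConditionH.eVariationOn_translate_le (hlam : 0 < lam) (hH : ConditionH lam C u)
    (hM : LInftyBVBound M u) {γ : ℝ → ℝ} {a b : ℝ} (hγ : IsSpaceLike lam γ a b) {ε : ℝ}
    (hε : 0 < ε) (s : ℝ) :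
    eVariationOn (fun x => u (γ x + ε) (x + s)) (Icc a b) ≤
      ENNReal.ofReal C * ENNReal.ofReal M := by
  rcases lt_or_ge b a with hab | hab
  · rw [Icc_eq_empty (not_le.2 hab), eVariationOn.subsingleton _ subsingleton_empty]
    exact zero_le
  -- Projection onto `[a, b]` after undoing the shift. It extends the translated curve by constants
  -- to a larger open interval, because `totVar` ignores end-points whereas the claim includes them.
  set P : ℝ → ℝ := fun y => max a (min (y - s) b) with hP
  have hPmem : ∀ y, P y ∈ Icc a b := fun y =>
    ⟨le_max_left _ _, max_le hab (min_le_right _ _)⟩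
  have hPid : ∀ x ∈ Icc a b, P (x + s) = x := fun x hx => by
    simp only [hP, add_sub_cancel_right]
    rw [min_eq_left hx.2, max_eq_right hx.1]
  have hPlip : ∀ y z, y < z → P y ≤ P z ∧ P z - P y ≤ z - y := by
    intro y z hyz
    have hmin : min (y - s) b ≤ min (z - s) b := min_le_min_right _ (by linarith)
    refine ⟨max_le_max_left _ hmin, ?_⟩
    have h1 : min (z - s) b ≤ min (y - s) b + (z - y) := by
      rw [← min_add_add_right]
      exact min_le_min (by linarith) (by linarith)
    have h2 : P z ≤ P y + (z - y) := by
      refine max_le ?_ (h1.trans ?_)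
      · linarith [(hPmem y).1]
      · linarith [le_max_right a (min (y - s) b)]
    linarith
  -- The upward shift leaves room for a horizontal line at a time where the `BV` bound holds.
  obtain ⟨r, hr, hrM⟩ := hM.exists_mem_Ioo le_rfl hε
  have hcurve : IsSpaceLike lam (fun y => γ (P y) + ε) (a + s - 1) (b + s + 1) := by
    refine ⟨fun y _ => add_nonneg (hγ.1 _ (hPmem y)) hε.le, fun y _ z _ hyz => ?_⟩
    obtain ⟨h1, h2⟩ := hPlip y z hyz
    simp only [add_sub_add_right_eq_sub]
    rcases h1.eq_or_lt with h | h
    · rw [h, sub_self, abs_zero]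
      exact div_pos (sub_pos.2 hyz) hlam
    · exact (hγ.2 _ (hPmem y) _ (hPmem z) h).trans_le (by gcongr)
  have htot := hH.totVar_le hlam hr.1.le hrM (by linarith) hcurve
    fun y _ => by linarith [hγ.1 _ (hPmem y), hr.2]
  refine le_trans ?_ htot
  have hcomp := eVariationOn.comp_le_of_monotoneOn (fun y => u (γ (P y) + ε) y)
    (s := Ioo (a + s - 1) (b + s + 1)) (t := Icc a b) (fun x => x + s)
    (fun x _ y _ h => add_le_add_left h s)
    fun x hx => ⟨by linarith [hx.1], by linarith [hx.2]⟩
  refine le_trans (le_of_eq (eVariationOn.congr fun x hx => ?_)) hcomp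
  simp only [Function.comp_apply, hPid x hx]

/-- The line at height `t` is the line at height `0` lifted by `ε = t`. This improves an
almost-every-time bound to every positive time. -/
theorem ConditionH.eVariationOn_le (hlam : 0 < lam) (hH : ConditionH lam C u)
    (hM : LInftyBVBound M u) {t : ℝ} (ht : 0 < t) :
    eVariationOn (u t) univ ≤ ENNReal.ofReal C * ENNReal.ofReal M := by
  rw [eVariationOn.eq_biSup_inter_Icc]
  refine iSup₂_le fun p _ => ?_
  have hγ : IsSpaceLike lam (fun _ => 0) p.1 p.2 :=
    ⟨fun _ _ => le_rfl, fun x₁ _ x₂ _ h => by simpa using div_pos (sub_pos.2 h) hlam⟩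
  simpa using hH.eVariationOn_translate_le hlam hM hγ ht 0

/-- The essential bound holds at some point, and the variation carries it to every point; each
contributes one `max M 0`. -/
theorem norm_le_of_bvNorm_le {f : ℝ → State d} (hf : bvNorm f ≤ ENNReal.ofReal M) (x : ℝ) :
    ‖f x‖ ≤ 2 * max M 0 := by
  have hof : ENNReal.ofReal M = ENNReal.ofReal (max M 0) := by
    rcases le_total M 0 with h | h <;> simp [h, ENNReal.ofReal_of_nonpos]
  have h1 : ∀ᵐ y, ‖f y‖ₑ ≤ ENNReal.ofReal (max M 0) := by
    filter_upwards [ae_le_eLpNormEssSup (f := f) (μ := volume)] with y hy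
    rw [← eLpNorm_exponent_top] at hy
    exact hy.trans (le_self_add.trans (hf.trans hof.le))
  obtain ⟨y, -, hy⟩ := exists_mem_Ioo_of_ae h1 (zero_lt_one (α := ℝ))
  have h2 : edist (f x) (f y) ≤ ENNReal.ofReal (max M 0) :=
    (eVariationOn.edist_le f (mem_univ x) (mem_univ y)).trans (le_add_self.trans (hf.trans hof.le))
  rw [← ofReal_norm, ENNReal.ofReal_le_ofReal_iff (le_max_right _ _)] at hy
  rw [edist_dist, ENNReal.ofReal_le_ofReal_iff (le_max_right _ _), dist_eq_norm] at h2
  have := norm_add_le (f x - f y) (f y)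
  rw [sub_add_cancel] at this
  linarith

/-- At some `y` the function is constant for a short time after `t`, so a good later time bounds `u
t y`; the variation at time `t` handles the other points. -/
theorem norm_le_of_conditionH (hlam : 0 < lam) (hH : ConditionH lam C u)
    (hM : LInftyBVBound M u) (hu : IsPiecewiseConstant u) {t : ℝ} (ht : 0 < t) (x : ℝ) :
    ‖u t x‖ ≤ 2 * max M 0 + (ENNReal.ofReal C * ENNReal.ofReal M).toReal := by
  obtain ⟨y, -, hy⟩ := exists_mem_Ioo_of_ae (hu.ae_eventually_eq ht.le) (zero_lt_one (α := ℝ))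
  have hy' : ∀ᶠ s in 𝓝[>] t, u s y = u t y :=
    hy.filter_mono (nhdsWithin_mono _ fun s (hs : t < s) => (ht.trans hs).le)
  obtain ⟨r, hr, hsub⟩ := (mem_nhdsGT_iff_exists_Ioo_subset).1 hy'
  obtain ⟨s, hs, hsM⟩ := hM.exists_mem_Ioo ht.le hr
  have h1 : ‖u t y‖ ≤ 2 * max M 0 := by
    have : u s y = u t y := hsub hs
    rw [← this]
    exact norm_le_of_bvNorm_le hsM y
  have h2 : dist (u t x) (u t y) ≤ (ENNReal.ofReal C * ENNReal.ofReal M).toReal := by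
    rw [dist_edist]
    exact ENNReal.toReal_mono (ENNReal.mul_ne_top ENNReal.ofReal_ne_top ENNReal.ofReal_ne_top)
      ((eVariationOn.edist_le _ (mem_univ x) (mem_univ y)).trans (hH.eVariationOn_le hlam hM ht))
  have := norm_add_le (u t x - u t y) (u t y)
  rw [sub_add_cancel, ← dist_eq_norm] at this
  linarith

end Variation

/-! ### Correction at the initial time. -/

section Extension

variable {d : ℕ} {lam C M : ℝ}

/-- Correction of `u` at time `0`, and extension to negative times, by a limit as `t → 0⁺`. -/
theorem exists_extension {u : ℝ → ℝ → State d} (hlam : 0 < lam) (hH : ConditionH lam C u)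
    (hM : LInftyBVBound M u) (hu : IsPiecewiseConstant u) (hC : 0 < C)
    (hLip : LipschitzInTime C u) :
    ∃ f : ℝ → ℝ → State d, (∀ t, 0 < t → f t = u t) ∧ (∀ t, 0 ≤ t → f t =ᵐ[volume] u t) ∧
      (∀ t, AEStronglyMeasurable (f t) volume) ∧
      (∀ t, eVariationOn (f t) univ ≤ ENNReal.ofReal C * ENNReal.ofReal M) ∧
      (∀ t x, ‖f t x‖ ≤ 2 * max M 0 + (ENNReal.ofReal C * ENNReal.ofReal M).toReal) ∧
      ∀ s t, eLpNorm (fun x => f t x - f s x) 1 volume ≤ ENNReal.ofReal (C * |t - s|) := by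
  -- The ultrafilter limit exists at every `x`, so the pointwise bounds for `t > 0` pass to it; off
  -- the fronts it equals `u 0`.
  set l : Ultrafilter ℝ := Ultrafilter.of (𝓝[>] (0 : ℝ)) with hl
  have hle : (l : Filter ℝ) ≤ 𝓝[>] (0 : ℝ) := Ultrafilter.of_le _
  have hpos : ∀ᶠ s in (l : Filter ℝ), 0 < s := hle self_mem_nhdsWithin
  choose g hg using fun x => exists_tendsto_ultrafilter l (u := fun s => u s x)
    (hpos.mono fun s hs => norm_le_of_conditionH hlam hH hM hu hs x)
  have hg0 : g =ᵐ[volume] u 0 := by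
    filter_upwards [hu.ae_eventually_eq le_rfl] with x hx
    have h1 : ∀ᶠ s in (l : Filter ℝ), u s x = u 0 x :=
      (hx.filter_mono (nhdsWithin_mono _ Ioi_subset_Ici_self)).filter_mono hle
    exact tendsto_nhds_unique (hg x) (tendsto_const_nhds.congr' (h1.mono fun s hs => hs.symm))
  have hf0 : ∀ {t : ℝ}, 0 < t → (fun x => if 0 < t then u t x else g x) = u t := fun ht => by
    ext x; simp [ht]
  have hf1 : ∀ {t : ℝ}, t ≤ 0 → (fun x => if 0 < t then u t x else g x) = g := fun ht => by
    ext x; simp [not_lt.2 ht]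
  have hg_meas : AEStronglyMeasurable g volume :=
    (hu.aestronglyMeasurable_slice le_rfl).congr hg0.symm
  have hL0 : ∀ t, 0 < t → eLpNorm (fun x => u t x - g x) 1 volume ≤ ENNReal.ofReal (C * t) := by
    intro t ht
    have hs0 : Tendsto (fun k : ℕ => 1 / ((k : ℝ) + 1)) atTop (𝓝[Ici 0] 0) :=
      tendsto_nhdsWithin_iff.2 ⟨tendsto_one_div_add_atTop_nhds_zero_nat,
        Eventually.of_forall fun k => by simp only [mem_Ici]; positivity⟩
    refine (Lp.eLpNorm_lim_le_liminf_eLpNorm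
      (f := fun (k : ℕ) x => u t x - u (1 / ((k : ℝ) + 1)) x)
      (fun k => (hu.aestronglyMeasurable_slice ht.le).sub
        (hu.aestronglyMeasurable_slice (by positivity))) _ ?_).trans ?_
    · filter_upwards [hu.ae_eventually_eq le_rfl, hg0] with x hx hgx
      rw [hgx]
      exact tendsto_const_nhds.sub
        (tendsto_const_nhds.congr' ((hs0.eventually hx).mono fun k hk => hk.symm))
    · refine liminf_le_of_frequently_le' (Eventually.frequently ?_)
      filter_upwards [(tendsto_one_div_add_atTop_nhds_zero_nat (𝕜 := ℝ)).eventually_lt_const ht]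
        with k hk
      have hk0 : (0 : ℝ) < 1 / ((k : ℝ) + 1) := by positivity
      refine (hLip _ t hk0 hk).trans (ENNReal.ofReal_le_ofReal ?_)
      rw [abs_of_pos (sub_pos.2 hk)]
      gcongr
      linarith
  refine ⟨fun t x => if 0 < t then u t x else g x, fun t ht => hf0 ht, fun t ht => ?_,
    fun t => ?_, fun t => ?_, fun t x => ?_, fun s t => ?_⟩
  · rcases ht.eq_or_lt with rfl | ht
    · simpa using hg0
    · exact (hf0 ht).eventuallyEq
  · rcases lt_or_ge 0 t with ht | ht
    · beta_reduce
      rw [hf0 ht]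
      exact hu.aestronglyMeasurable_slice ht.le
    · beta_reduce
      rw [hf1 ht]
      exact hg_meas
  · rcases lt_or_ge 0 t with ht | ht
    · beta_reduce
      rw [hf0 ht]
      exact hH.eVariationOn_le hlam hM ht
    · beta_reduce
      rw [hf1 ht]
      exact eVariationOn_le_of_tendsto (fun x _ => hg x)
        (hpos.mono fun s hs => hH.eVariationOn_le hlam hM hs)
  · rcases lt_or_ge 0 t with ht | ht
    · simpa [ht] using norm_le_of_conditionH hlam hH hM hu ht x
    · simpa [not_lt.2 ht] using le_of_tendsto (hg x).norm
        (hpos.mono fun s hs => norm_le_of_conditionH hlam hH hM hu hs x)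
  · wlog hst : s ≤ t generalizing s t
    · rw [eLpNorm_sub_comm', abs_sub_comm]
      exact this t s (not_le.1 hst).le
    rcases hst.eq_or_lt with rfl | hst
    · simp
    rcases lt_or_ge 0 s with hs | hs
    · simpa only [hs, hs.trans hst, if_true] using hLip s t hs hst
    rcases lt_or_ge 0 t with ht | ht
    · simp only [not_lt.2 hs, ht, if_true, if_false]
      refine (hL0 t ht).trans (ENNReal.ofReal_le_ofReal ?_)
      rw [abs_of_pos (sub_pos.2 hst)]
      gcongr
      linarith
    · simp [not_lt.2 hs, not_lt.2 ht]

end Extension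

end SpaceLike

namespace SpaceLike

/-! ### Passage to the limit along translated curves. -/

section Limit

variable {E : Type*} [NormedAddCommGroup E]

/-- The limit inherits the Lipschitz continuity in time. -/
theorem eLpNorm_sub_le_of_ae_tendsto {f : ℕ → ℝ → ℝ → E} {ψ : ℝ → ℝ → E} {C : ℝ}
    (hm : ∀ n t, AEStronglyMeasurable (f n t) volume)
    (hL : ∀ n s t, eLpNorm (fun x => f n t x - f n s x) 1 volume ≤ ENNReal.ofReal (C * |t - s|))
    (hlim : ∀ t, ∀ᵐ x, Tendsto (fun n => f n t x) atTop (𝓝 (ψ t x))) (s t : ℝ) :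
    eLpNorm (fun x => ψ t x - ψ s x) 1 volume ≤ ENNReal.ofReal (C * |t - s|) := by
  refine (Lp.eLpNorm_lim_le_liminf_eLpNorm (f := fun n x => f n t x - f n s x)
    (fun n => (hm n t).sub (hm n s)) _ ?_).trans ?_
  · filter_upwards [hlim t, hlim s] with x h1 h2 using h1.sub h2
  · exact liminf_le_of_frequently_le' (Frequently.of_forall fun n => hL n s t)

/-- Fast convergence in `L¹` permits shifting the time by a geometric sequence. -/
theorem ae_tendsto_time_shift {f : ℕ → ℝ → ℝ → E} {ψ : ℝ → ℝ → E} {C : ℝ} (hC : 0 < C)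
    (hm : ∀ n t, AEStronglyMeasurable (f n t) volume)
    (hψ : ∀ t, AEStronglyMeasurable (ψ t) volume)
    (hL : ∀ n s t, eLpNorm (fun x => f n t x - f n s x) 1 volume ≤ ENNReal.ofReal (C * |t - s|))
    (hfast : ∀ n : ℕ, ∀ t : ℝ, |t| ≤ n →
      eLpNorm (fun x => f n t x - ψ t x) 1 (interval n) ≤ 2⁻¹ ^ n) (t : ℝ) :
    ∀ᵐ x, Tendsto (fun n : ℕ => f n (t + 2⁻¹ ^ n) x) atTop (𝓝 (ψ t x)) := by
  have hmi : ∀ n t (R : ℝ), AEStronglyMeasurable (f n t) (interval R) := fun n t R =>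
    (hm n t).mono_measure (interval_le R)
  have hψi : ∀ t (R : ℝ), AEStronglyMeasurable (ψ t) (interval R) := fun t R =>
    (hψ t).mono_measure (interval_le R)
  obtain ⟨K, hK⟩ := exists_nat_ge |t|
  refine ae_of_forall_interval K fun k hk => ?_
  -- In the constant `C + 1`, `C` pays for the time shift and `1` for the distance from `f` to `ψ`.
  have h := ae_tendsto_of_tsum_eLpNorm (μ := interval k)
    (f := fun n => f (n + k) (t + 2⁻¹ ^ (n + k))) (g := ψ t)
    (fun n => (hmi _ _ _).sub (hψi _ _))
    (tsum_half_ne_top (ENNReal.ofReal C + 1) (by simp)) fun n => by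
      have hp : (2⁻¹ : ℝ≥0∞) ^ (n + k) ≤ 2⁻¹ ^ n :=
        pow_le_pow_right_of_le_one' (by simp) (Nat.le_add_right _ _)
      have hkt : |t| ≤ ((n + k : ℕ) : ℝ) :=
        hK.trans (by exact_mod_cast hk.trans (Nat.le_add_left _ _))
      have h1 : eLpNorm (fun x => f (n + k) (t + 2⁻¹ ^ (n + k)) x - f (n + k) t x) 1 (interval k)
          ≤ ENNReal.ofReal C * 2⁻¹ ^ n := by
        refine ((eLpNorm_mono_measure _ (interval_le _)).trans (hL _ _ _)).trans ?_
        rw [add_sub_cancel_left, abs_of_nonneg (by positivity), ENNReal.ofReal_mul hC.le,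
          ENNReal.ofReal_pow (by norm_num), ENNReal.ofReal_inv_of_pos (by norm_num),
          ENNReal.ofReal_ofNat]
        gcongr
      have h2 : eLpNorm (fun x => f (n + k) t x - ψ t x) 1 (interval k) ≤ 2⁻¹ ^ n :=
        ((eLpNorm_mono_measure _ (interval_mono (by exact_mod_cast Nat.le_add_left _ _))).trans
          (hfast (n + k) t hkt)).trans hp
      refine ((eLpNorm_sub_triangle le_rfl (hmi _ _ _) (hmi (n + k) t k) (hψi t k)).trans
        (add_le_add h1 h2)).trans ?_
      rw [add_mul, one_mul]
  filter_upwards [h] with x hx using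
    (tendsto_add_atTop_iff_nat (f := fun n : ℕ => f n (t + 2⁻¹ ^ n) x) k).1 hx

/-- Bounds on sums of jumps along translated polygons pass to a right-continuous limit: the
translates of given points in space see almost every value of the slices. -/
theorem sum_edist_le_of_translates {f : ℕ → ℝ → ℝ → E} {ψ : ℝ → ℝ → E} {V : ℝ≥0∞}
    (hr : ∀ t x, ContinuousWithinAt (ψ t) (Ici x) x)
    (hlim : ∀ t, ∀ᵐ x, Tendsto (fun n : ℕ => f n (t + 2⁻¹ ^ n) x) atTop (𝓝 (ψ t x)))
    {m : ℕ} {t x : ℕ → ℝ}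
    (hV : ∀ n : ℕ, ∀ s, ∑ i ∈ Finset.range m, edist (f n (t (i + 1) + 2⁻¹ ^ n) (x (i + 1) + s))
      (f n (t i + 2⁻¹ ^ n) (x i + s)) ≤ V) :
    ∑ i ∈ Finset.range m, edist (ψ (t (i + 1)) (x (i + 1))) (ψ (t i) (x i)) ≤ V := by
  have h1 : ∀ᵐ s : ℝ, ∀ i, Tendsto (fun n : ℕ => f n (t i + 2⁻¹ ^ n) (x i + s)) atTop
      (𝓝 (ψ (t i) (x i + s))) :=
    ae_all_iff.2 fun i =>
      (measurePreserving_add_left volume (x i)).quasiMeasurePreserving.ae (hlim (t i))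
  have h2 : ∀ᵐ s : ℝ, ∑ i ∈ Finset.range m,
      edist (ψ (t (i + 1)) (x (i + 1) + s)) (ψ (t i) (x i + s)) ≤ V := by
    filter_upwards [h1] with s hs
    exact le_of_tendsto (tendsto_finsetSum _ fun i _ => (hs (i + 1)).edist (hs i))
      (Eventually.of_forall fun n => hV n s)
  have h3 : ∀ i, Tendsto (fun s => ψ (t i) (x i + s)) (𝓝[>] 0) (𝓝 (ψ (t i) (x i))) := by
    intro i
    have hadd : Tendsto (fun s => x i + s) (𝓝[>] 0) (𝓝[≥] (x i)) := by
      refine tendsto_nhdsWithin_iff.2 ⟨?_, ?_⟩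
      · simpa using ((continuous_const_add (x i)).tendsto 0).mono_left nhdsWithin_le_nhds
      · filter_upwards [self_mem_nhdsWithin] with s hs
        simpa using (mem_Ioi.1 hs).le
    exact (hr (t i) (x i)).tendsto.comp hadd
  -- The bound holds only for almost every `s`, but good values of `s` accumulate at `0` from the
  -- right.
  refine le_of_tendsto_of_frequently
    (tendsto_finsetSum (Finset.range m) fun i _ => (h3 (i + 1)).edist (h3 i)) ?_
  rw [frequently_iff]
  intro U hU
  obtain ⟨r, hr, hsub⟩ := mem_nhdsGT_iff_exists_Ioo_subset.1 hU
  obtain ⟨s, hs, hsV⟩ := exists_mem_Ioo_of_ae h2 hr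
  exact ⟨s, hsub hs, hsV⟩

end Limit

/-! ### Continuity in time with values in `L¹` and `L²`. -/

section ContinuityInTime

variable {d : ℕ}

theorem tendsto_eLpNorm_one_of_lipschitz {u : ℝ → ℝ → State d} {C : ℝ}
    (hL : ∀ s t, 0 ≤ s → 0 ≤ t →
      eLpNorm (fun x => u t x - u s x) 1 volume ≤ ENNReal.ofReal (C * |t - s|))
    {t : ℝ} (ht : 0 ≤ t) (R : ℝ) :
    Tendsto (fun s => eLpNorm (fun x => u s x - u t x) 1 (interval R)) (𝓝[Ici 0] t) (𝓝 0) := by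
  have h : Tendsto (fun s => ENNReal.ofReal (C * |s - t|)) (𝓝[Ici 0] t) (𝓝 0) := by
    have hc : Continuous fun s => ENNReal.ofReal (C * |s - t|) :=
      ENNReal.continuous_ofReal.comp (by fun_prop)
    simpa using (hc.tendsto t).mono_left nhdsWithin_le_nhds
  refine tendsto_of_tendsto_of_tendsto_of_le_of_le' tendsto_const_nhds h
    (Eventually.of_forall fun _ => zero_le) ?_
  filter_upwards [self_mem_nhdsWithin] with s hs
  exact (eLpNorm_mono_measure _ (interval_le R)).trans (hL t s ht hs)

theorem ae_norm_sub_le {α : Type*} [MeasurableSpace α] {μ : Measure α} {f g : α → State d} {B : ℝ}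
    (hf : ∀ᵐ x ∂μ, ‖f x‖ ≤ B) (hg : ∀ᵐ x ∂μ, ‖g x‖ ≤ B) : ∀ᵐ x ∂μ, ‖f x - g x‖ ≤ 2 * B := by
  filter_upwards [hf, hg] with x h1 h2
  linarith [norm_sub_le (f x) (g x)]

theorem tendsto_rpow_half {ι : Type*} {l : Filter ι} {a : ι → ℝ≥0∞} (ha : Tendsto a l (𝓝 0))
    (K : ℝ) : Tendsto (fun i => (ENNReal.ofReal K * a i) ^ (1 / 2 : ℝ)) l (𝓝 0) := by
  have h := (ENNReal.continuous_rpow_const (y := (1 / 2 : ℝ))).tendsto 0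
  rw [ENNReal.zero_rpow_of_pos (by norm_num)] at h
  have h' := ENNReal.Tendsto.const_mul (a := ENNReal.ofReal K) ha (Or.inr ENNReal.ofReal_ne_top)
  rw [mul_zero] at h'
  exact h.comp h'

theorem memC0L2_of_lipschitz {u : ℝ → ℝ → State d} {B C : ℝ}
    (hm : ∀ t, 0 ≤ t → AEStronglyMeasurable (u t) volume)
    (hB : ∀ t, 0 ≤ t → ∀ᵐ x, ‖u t x‖ ≤ B)
    (hL : ∀ s t, 0 ≤ s → 0 ≤ t →
      eLpNorm (fun x => u t x - u s x) 1 volume ≤ ENNReal.ofReal (C * |t - s|)) (T R : ℝ) :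
    MemC0L2 T R u := by
  refine ⟨fun t ht => MemLp.of_bound ((hm t ht.1).mono_measure (interval_le R)) B
    (ae_mono (interval_le R) (hB t ht.1)), fun t ht => ?_⟩
  refine tendsto_of_tendsto_of_tendsto_of_le_of_le' tendsto_const_nhds
    (tendsto_rpow_half ((tendsto_eLpNorm_one_of_lipschitz hL ht.1 R).mono_left
      (nhdsWithin_mono t Icc_subset_Ici_self)) (2 * B))
    (Eventually.of_forall fun _ => zero_le) ?_
  filter_upwards [self_mem_nhdsWithin] with s hs
  exact eLpNorm_two_le (ae_mono (interval_le R) (ae_norm_sub_le (hB s hs.1) (hB t ht.1)))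

end ContinuityInTime

end SpaceLike

theorem lemma2p6 {d : ℕ} (lam : ℝ) (hlam : 0 < lam)
    (ψn : ℕ → ℝ → ℝ → SpaceLike.State d)
    (hpc : ∀ n, SpaceLike.IsPiecewiseConstant (ψn n))
    (M : ℝ) (hM : ∀ n, SpaceLike.LInftyBVBound M (ψn n))
    (C : ℝ) (hC : 0 < C)
    (hH : ∀ n, SpaceLike.ConditionH lam C (ψn n))
    (hLip : ∀ n, SpaceLike.LipschitzInTime C (ψn n)) :
    ∃ ψ : ℝ → ℝ → SpaceLike.State d,
      MemLp (fun p : ℝ × ℝ => ψ p.1 p.2) ∞ SpaceLike.halfPlane ∧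
      SpaceLike.BoundedVariationCondition lam ψ ∧
      ∃ φ : ℕ → ℕ, StrictMono φ ∧
        (∀ T R : ℝ, 0 < T → 0 < R →
          SpaceLike.TendstoC0L2 T R (fun n => ψn (φ n)) ψ) ∧
        ∀ᵐ p ∂SpaceLike.halfPlane,
          Tendsto (fun n => ψn (φ n) p.1 p.2) atTop (𝓝 (ψ p.1 p.2)) := by
  open SpaceLike in
  choose f hfpos hfae hfm hfV hfB hfL using fun n =>
    exists_extension hlam (hH n) (hM n) (hpc n) hC (hLip n)
  have hVtop : ENNReal.ofReal C * ENNReal.ofReal M ≠ ∞ :=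
    ENNReal.mul_ne_top ENNReal.ofReal_ne_top ENNReal.ofReal_ne_top
  obtain ⟨φ, ψ, hφ, hr, hB, hlim, hfast⟩ := exists_subseq_limit hfm hVtop hfV hfB hC hfL
  set B := 2 * max M 0 + (ENNReal.ofReal C * ENNReal.ofReal M).toReal
  have hψm : ∀ t, AEStronglyMeasurable (ψ t) volume := fun t =>
    aestronglyMeasurable_of_tendsto_ae _ (fun n => hfm (φ n) t) (hlim t)
  have hψL := eLpNorm_sub_le_of_ae_tendsto (fun n t => hfm (φ n) t) (fun n => hfL (φ n)) hlim
  have hψjoint : AEStronglyMeasurable (fun p : ℝ × ℝ => ψ p.1 p.2) halfPlane :=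
    (stronglyMeasurable_uncurry_of_rightContinuous hr hB hψm hC hψL).aestronglyMeasurable
  refine ⟨ψ, memLp_top_of_bound hψjoint B (Eventually.of_forall fun p => hB _ _),
    ⟨fun t _ x => hr t x, fun t ht R =>
      tendsto_eLpNorm_one_of_lipschitz (fun s t _ _ => hψL s t) ht R,
      1, one_pos, fun γ a b hγ _ => ?_⟩, φ, hφ, fun T R hT hR => ⟨fun n => ?_, ?_, ?_⟩, ?_⟩
  -- Each partition of the curve is treated separately, with times `γ (x i)`. The shifted points
  -- have positive time, where `f` and `ψn` agree everywhere.
  · refine ne_top_of_le_ne_top hVtop (iSup_le fun ⟨m, x, hxm, hxs⟩ => ?_)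
    refine sum_edist_le_of_translates (f := fun n => f (φ n)) (t := fun i => γ (x i)) hr
      (ae_tendsto_time_shift hC (fun n => hfm (φ n)) hψm (fun n => hfL (φ n)) hfast) fun n s => ?_
    have hε : (0 : ℝ) < 2⁻¹ ^ n := by positivity
    have h := (hH (φ n)).eVariationOn_translate_le hlam (hM (φ n)) hγ hε s
    refine le_trans (le_of_eq (Finset.sum_congr rfl fun i _ => ?_))
      ((eVariationOn.sum_le hxm hxs (n := m)).trans h)
    rw [hfpos _ _ (add_pos_of_nonneg_of_pos (hγ.1 _ (hxs _)) hε),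
      hfpos _ _ (add_pos_of_nonneg_of_pos (hγ.1 _ (hxs _)) hε)]
  · refine memC0L2_of_lipschitz (B := B) (C := C)
      (fun t ht => (hpc (φ n)).aestronglyMeasurable_slice ht) (fun t ht => ?_)
      (fun s t hs ht => ?_) T R
    · filter_upwards [hfae (φ n) t ht] with x hx
      exact hx ▸ hfB (φ n) t x
    · refine le_trans (le_of_eq (eLpNorm_congr_ae ?_)) (hfL (φ n) s t)
      exact (hfae (φ n) t ht).symm.sub (hfae (φ n) s hs).symm
  · exact memC0L2_of_lipschitz (fun t _ => hψm t)
      (fun t _ => Eventually.of_forall fun x => hB t x) (fun s t _ _ => hψL s t) T R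
  · have hpow : Tendsto (fun n : ℕ => (2⁻¹ : ℝ≥0∞) ^ n) atTop (𝓝 0) :=
      ENNReal.tendsto_pow_atTop_nhds_zero_of_lt_one (by norm_num)
    refine tendsto_of_tendsto_of_tendsto_of_le_of_le' tendsto_const_nhds
      (tendsto_rpow_half hpow (2 * B)) (Eventually.of_forall fun _ => zero_le) ?_
    obtain ⟨K, hK⟩ := exists_nat_ge (max T R)
    filter_upwards [eventually_ge_atTop K] with n hn
    have hKn : (K : ℝ) ≤ n := by exact_mod_cast hn
    have hTn : T ≤ n := (le_max_left _ _).trans (hK.trans hKn)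
    have hRn : R ≤ n := (le_max_right _ _).trans (hK.trans hKn)
    refine iSup₂_le fun t ht => ?_
    have htn : |t| ≤ n := by
      rw [abs_of_nonneg ht.1]
      exact ht.2.trans hTn
    have hae : (fun x => ψn (φ n) t x - ψ t x) =ᵐ[interval R] fun x => f (φ n) t x - ψ t x := by
      filter_upwards [ae_mono (interval_le R) (hfae (φ n) t ht.1)] with x hx
      rw [hx]
    rw [eLpNorm_congr_ae hae]
    refine (eLpNorm_two_le (ae_norm_sub_le (Eventually.of_forall fun x => hfB (φ n) t x)
      (Eventually.of_forall fun x => hB t x))).trans ?_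
    gcongr
    exact (eLpNorm_mono_measure _ (interval_mono hRn)).trans (hfast n t htn)
  -- Convergence on almost every point of each slice becomes convergence on the half plane by
  -- Fubini.
  · have hjoint := fun n => (hpc (φ n)).aestronglyMeasurable
    rw [halfPlane_eq_prod] at hψjoint hjoint ⊢
    refine ae_prod_tendsto hjoint hψjoint ?_
    filter_upwards [ae_restrict_mem measurableSet_Ici] with t ht
    have hall : ∀ᵐ x, ∀ n, f (φ n) t x = ψn (φ n) t x :=
      ae_all_iff.2 fun n => hfae (φ n) t ht
    filter_upwards [hlim t, hall] with x hx hx'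
    simpa only [hx'] using hx
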